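/- Let $(R,\mathfrak m)$ be a commutative Noetherian local ring. An $R$-module $M$ is called Ext-finite if $\operatorname{Ext}^i_R(N,M)$ is a finitely generated $R$-module for every finitely generated $R$-module $N$ and every $i\ge 1$. For a complex $I=(\cdots\to I_{i+1}\to I_i\to I_{i-1}\to\cdots)$ of $R$-modules put $\inf I=\inf\{i\in\mathbb Z: I_i\ne 0\}$, $\sup I=\sup\{i\in\mathbb Z: I_i\neq 0\}$ and $\operatorname{hinf} I=\inf\{i\in\mathbb Z: H_i(I)\ne 0\}$. A quasi-injective resolution of $M$ is a bounded above complex $I$ of injective $R$-modules (i.e. $I_i=0$ for all $i\gg 0$) for which there are non-negative integers $b_i$ ($i\le\sup I$), not all zero, with $H_i(I)\cong M^{\oplus b_i}$ for all $i\le \sup I$; it is bounded if $I_i=0$ for all but finitely many $i$. For $M\ne 0$, the quasi-injective dimension of $M$ is $$\operatorname{qid}_R M=\inf\{\operatorname{hinf} I-\inf I : I \text{ is a bounded quasi-injective resolution of } M\},$$ which is $\infty$ if $M$ has no bounded quasi-injective resolution; and $\operatorname{qid}_R 0=-\infty$. Let $\operatorname{depth} R$ be the supremum of the lengths of the $R$-regular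 sequences contained in $\mathfrak m$. If $M$ is a nonzero Ext-finite $R$-module with $\operatorname{qid}_R M<\infty$, then $$\operatorname{qid}_R M\le \operatorname{depth} R.$$ -/

import Mathlib

open CategoryTheory

universe u v

/-- A module `M` over a commutative ring `R` is *Ext-finite* if, for every finitely generated
`R`-module `N` and every `i ≥ 1`, the `R`-module `Ext^i_R(N, M)` is finitely generated. -/
def IsExtFinite (R : Type u) [CommRing R] [Small.{v} R]
    (M : Type v) [AddCommGroup M] [Module R M] : Prop :=
  ∀ N : ModuleCat.{v} R, Module.Finite R N → ∀ i : ℕ, 1 ≤ i →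
    Module.Finite R (Abelian.Ext N (ModuleCat.of R M) i)

/-- `I` is a *quasi-injective resolution* of `M`: a complex (homologically indexed by `ℤ`) of
injective modules, bounded above, such that `H_i(I) ≅ M ^ (b i)` for natural numbers `b i`,
not all of which are zero. (Above the top degree of `I` the homology vanishes, so that the
condition there is met by `b i = 0`.) -/
structure IsQuasiInjectiveResolution (R : Type u) [CommRing R]
    (M : Type v) [AddCommGroup M] [Module R M]
    (I : ChainComplex (ModuleCat.{v} R) ℤ) : Prop where
  boundedAbove : ∃ n : ℤ, ∀ i : ℤ, n < i → Limits.IsZero (I.X i)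
  injective : ∀ i : ℤ, Injective (I.X i)
  homology : ∃ b : ℤ → ℕ, (∃ i, b i ≠ 0) ∧
    ∀ i : ℤ, Nonempty (I.homology i ≃ₗ[R] (Fin (b i) → M))

/-- The complex `I` is bounded: its terms vanish outside a finite interval of degrees. -/
def IsBoundedChainComplex {R : Type u} [CommRing R]
    (I : ChainComplex (ModuleCat.{v} R) ℤ) : Prop :=
  ∃ m n : ℤ, ∀ i : ℤ, i < m ∨ n < i → Limits.IsZero (I.X i)

/-- `inf I = a`: the smallest degree in which the complex `I` is nonzero is `a`. -/
def HasInf {R : Type u} [CommRing R] (I : ChainComplex (ModuleCat.{v} R) ℤ) (a : ℤ) : Prop :=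
  IsLeast {i : ℤ | ¬ Limits.IsZero (I.X i)} a

/-- `hinf I = a`: the smallest degree in which `I` has nonzero homology is `a`. -/
def HasHinf {R : Type u} [CommRing R] (I : ChainComplex (ModuleCat.{v} R) ℤ) (a : ℤ) : Prop :=
  IsLeast {i : ℤ | ¬ Limits.IsZero (I.homology i)} a

open Classical in
/-- The *quasi-injective dimension* `qid_R M`: it is `-∞` if `M = 0`; otherwise it is the infimum
of the numbers `hinf I - inf I`, over all bounded quasi-injective resolutions `I` of `M`
(`∞` if there is none). For a bounded quasi-injective resolution of a nonzero module both
`inf I` and `hinf I` are integers with `inf I ≤ hinf I`, so that `hinf I = inf I + n` for a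
natural number `n`. -/
noncomputable def quasiInjectiveDimension (R : Type u) [CommRing R]
    (M : Type v) [AddCommGroup M] [Module R M] : WithBot ℕ∞ :=
  if Subsingleton M then ⊥
  else ((⨅ n ∈ {n : ℕ | ∃ I : ChainComplex (ModuleCat.{v} R) ℤ,
      IsQuasiInjectiveResolution R M I ∧ IsBoundedChainComplex I ∧
      ∃ a : ℤ, HasInf I a ∧ HasHinf I (a + n)}, (n : ℕ∞) : ℕ∞) : WithBot ℕ∞)

/-- The depth of a local ring `R`: the supremum of the lengths of the `R`-regular sequences
contained in the maximal ideal. -/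
noncomputable def localRingDepth (R : Type u) [CommRing R] [IsLocalRing R] : ℕ∞ :=
  ⨆ rs ∈ {rs : List R | (∀ r ∈ rs, r ∈ IsLocalRing.maximalIdeal R) ∧
    RingTheory.Sequence.IsRegular R rs}, (rs.length : ℕ∞)

open Abelian IsLocalRing RingTheory.Sequence
open scoped Pointwise

/-! ### Stability of Ext-finiteness -/

section ExtFinite

variable {R : Type u} [CommRing R] [Small.{v} R]

/-! Let `I` be a bounded quasi-injective resolution of `M`, `h = hinf I`, `d = depth R` finite, and
`Z_i`, `B_i` the cycles and boundaries. Since `I` is exact below `h`, the terms in degrees `≤ h`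
form a finite injective resolution of `Z_h`. Descending from the top degree along `0 → Z_{i+1} →
I_{i+1} → B_i → 0` and `0 → B_i → Z_i → H_i → 0` shows that `Z_h` is Ext-finite
(`IsQuasiInjectiveResolution.isExtFinite_cycles`).

Bass's argument needs only Ext-finiteness, not finite generation, and gives `Z_h` injective
dimension at most `d` (`IsExtFinite.hasInjectiveDimensionLE_of_localRingDepth_eq`). Hence the
cosyzygy `Z_{h-d}` is injective, and truncating `I` there keeps the homology while leaving at most
`d` degrees below `h`. -/

lemma CategoryTheory.ShortComplex.ShortExact.isExtFinite_X₂ [IsNoetherianRing R]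
    {S : ShortComplex (ModuleCat.{v} R)} (hS : S.ShortExact)
    (h₁ : IsExtFinite R S.X₁) (h₃ : IsExtFinite R S.X₃) : IsExtFinite R S.X₂ := by
  intro N hN i hi
  have f₁ : Module.Finite R (Ext N S.X₁ i) := h₁ N hN i hi
  have f₃ : Module.Finite R (Ext N S.X₃ i) := h₃ N hN i hi
  have : IsNoetherian R (Ext N S.X₁ i) := isNoetherian_of_isNoetherianRing_of_finite R _
  have : IsNoetherian R (Ext N S.X₃ i) := isNoetherian_of_isNoetherianRing_of_finite R _
  have : IsNoetherian R (Ext N S.X₂ i) :=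
    isNoetherian_of_range_eq_ker ((Ext.mk₀ S.f).postcompOfLinear R N (add_zero i))
      ((Ext.mk₀ S.g).postcompOfLinear R N (add_zero i)) (by
        symm
        rw [← LinearMap.exact_iff]
        exact (ShortComplex.ab_exact_iff_function_exact _).1
          (Ext.covariant_sequence_exact₂' N hS i))
  exact (inferInstance : Module.Finite R (Ext N S.X₂ i))

/-- For `i ≥ 1` the connecting map embeds `Ext^i(N, X₃)` in `Ext^{i+1}(N, X₁)`, as `Ext^i(N, X₂) =
0`. -/
lemma CategoryTheory.ShortComplex.ShortExact.isExtFinite_X₃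
    {S : ShortComplex (ModuleCat.{v} R)} (hS : S.ShortExact)
    [Injective S.X₂] [IsNoetherianRing R]
    (h₁ : IsExtFinite R S.X₁) : IsExtFinite R S.X₃ := by
  intro N hN i hi
  have : Module.Finite R (Ext N S.X₁ (i + 1)) := h₁ N hN (i + 1) (by lia)
  have : IsNoetherian R (Ext N S.X₁ (i + 1)) := isNoetherian_of_isNoetherianRing_of_finite R _
  refine Module.Finite.of_injective (M := Ext N S.X₃ i)
    (hS.extClass.postcompOfLinear R N (b := i + 1) rfl) ?_
  rw [injective_iff_map_eq_zero]
  intro x hx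
  obtain ⟨y, rfl⟩ := Ext.covariant_sequence_exact₃ _ hS x rfl hx
  obtain ⟨j, rfl⟩ := Nat.exists_eq_add_of_le' hi
  rw [y.eq_zero_of_injective, Ext.zero_comp]

lemma isExtFinite_of_subsingleton (X : ModuleCat.{v} R) [Subsingleton X] : IsExtFinite R X := by
  intro N _ i _
  have : HasInjectiveDimensionLT X 0 :=
    (ModuleCat.isZero_of_subsingleton X).hasInjectiveDimensionLT_zero
  have : Subsingleton (Ext N X i) := HasInjectiveDimensionLT.subsingleton X 0 i (Nat.zero_le _) N
  exact (inferInstance : Module.Finite R (Ext N X i))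

lemma IsExtFinite.of_linearEquiv_fin_fun [IsNoetherianRing R] {M : Type v} [AddCommGroup M]
    [Module R M] (hM : IsExtFinite R M) {b : ℕ} (X : ModuleCat.{v} R)
    (e : X ≃ₗ[R] (Fin b → M)) : IsExtFinite R X := by
  induction b generalizing X with
  | zero =>
    have := e.toEquiv.subsingleton
    exact isExtFinite_of_subsingleton X
  | succ b ih =>
    let f : M →ₗ[R] X := e.symm.toLinearMap ∘ₗ LinearMap.single R (fun _ : Fin (b + 1) ↦ M) 0
    let g : X →ₗ[R] (Fin b → M) := LinearMap.funLeft R M Fin.succ ∘ₗ e.toLinearMap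
    have hfg : Function.Exact f g := by
      intro x
      obtain ⟨y, rfl⟩ := e.symm.surjective x
      constructor
      · intro hy
        refine ⟨y 0, congrArg e.symm ?_⟩
        ext i
        refine Fin.cases (by simp) (fun j ↦ ?_) i
        simpa [g, LinearMap.funLeft_apply] using (congrFun hy j).symm
      · rintro ⟨m, hm⟩
        rw [← hm]
        ext j
        simp [f, g, LinearMap.funLeft_apply]
    have hf : Function.Injective f := 
      e.symm.injective.comp (Pi.single_injective (M := fun _ : Fin (b + 1) ↦ M) 0)
    have hg : Function.Surjective g :=
      (LinearMap.funLeft_surjective_of_injective R M _ (Fin.succ_injective b)).comp e.surjective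
    let S : ShortComplex (ModuleCat.{v} R) :=
      ModuleCat.shortComplexOfCompEqZero f g hfg.linearMap_comp_eq_zero
    have hS : S.ShortExact := ModuleCat.shortComplex_shortExact S hfg hf hg
    exact hS.isExtFinite_X₂ hM (ih (ModuleCat.of R (Fin b → M)) (LinearEquiv.refl R _))

end ExtFinite

/-! ### Injective dimension tested on finitely generated modules -/

section InjectiveDimension

variable {R : Type u} [CommRing R] [Small.{v} R]

lemma ModuleCat.injective_of_subsingleton_ext_one_finite (Z : ModuleCat.{v} R)
    (h : ∀ N : ModuleCat.{v} R, Module.Finite R N → Subsingleton (Ext N Z 1)) :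
    Injective Z := by
  have : Module.Injective R Z := by
    refine Module.Baer.injective fun J φ ↦ ?_
    -- Baer's criterion concerns ideals in universe `u`; `0 → J → R → R/J → 0` is moved to universe
    -- `v` so that `h` applies to `R/J`.
    let f : Shrink.{v} J →ₗ[R] Shrink.{v} R :=
      (Shrink.linearEquiv R R).symm.toLinearMap ∘ₗ J.subtype ∘ₗ
        (Shrink.linearEquiv R J).toLinearMap
    let g : Shrink.{v} R →ₗ[R] Shrink.{v} (R ⧸ J) :=
      (Shrink.linearEquiv R (R ⧸ J)).symm.toLinearMap ∘ₗ J.mkQ ∘ₗ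
        (Shrink.linearEquiv R R).toLinearMap
    have hf : Function.Injective f :=
      (Shrink.linearEquiv R R).symm.injective.comp
        (Subtype.val_injective.comp (Shrink.linearEquiv R J).injective)
    have hg : Function.Surjective g :=
      (Shrink.linearEquiv R (R ⧸ J)).symm.surjective.comp
        (J.mkQ_surjective.comp (Shrink.linearEquiv R R).surjective)
    have hfg : Function.Exact f g := by
      intro x
      obtain ⟨r, rfl⟩ := (Shrink.linearEquiv R R).symm.surjective x
      simp only [f, g, LinearMap.comp_apply, LinearEquiv.coe_coe, LinearEquiv.apply_symm_apply,
        LinearEquiv.map_eq_zero_iff, Submodule.mkQ_apply, Submodule.Quotient.mk_eq_zero,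
        Set.mem_range, EmbeddingLike.apply_eq_iff_eq]
      refine ⟨fun hr ↦ ⟨(Shrink.linearEquiv R J).symm ⟨r, hr⟩, by simp⟩, ?_⟩
      rintro ⟨y, rfl⟩
      exact ((Shrink.linearEquiv R J) y).2
    let S : ShortComplex (ModuleCat.{v} R) :=
      ModuleCat.shortComplexOfCompEqZero f g hfg.linearMap_comp_eq_zero
    have hS : S.ShortExact := ModuleCat.shortComplex_shortExact S hfg hf hg
    let φ' : S.X₁ ⟶ Z := ModuleCat.ofHom (φ ∘ₗ (Shrink.linearEquiv R J).toLinearMap)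
    have fin : Module.Finite R S.X₃ := Module.Finite.equiv (Shrink.linearEquiv R (R ⧸ J)).symm
    have := h S.X₃ fin
    obtain ⟨ψ, hψ⟩ := Ext.contravariant_sequence_exact₁ hS Z (Ext.mk₀ φ') (add_zero 1)
      (Subsingleton.elim _ _)
    obtain ⟨ψ, rfl⟩ := (Ext.mk₀_bijective S.X₂ Z).2 ψ
    rw [Ext.mk₀_comp_mk₀, (Ext.mk₀_bijective _ _).1.eq_iff] at hψ
    refine ⟨ψ.hom ∘ₗ (Shrink.linearEquiv R R).symm.toLinearMap, fun x hx ↦ ?_⟩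
    have := LinearMap.congr_fun (ModuleCat.hom_ext_iff.1 hψ) ((Shrink.linearEquiv R J).symm ⟨x, hx⟩)
    simpa [S, f, φ'] using this
  exact Module.injective_object_of_injective_module R Z

lemma ModuleCat.hasInjectiveDimensionLT_succ_of_forall_finite (Z : ModuleCat.{v} R) (n : ℕ)
    (h : ∀ N : ModuleCat.{v} R, Module.Finite R N → Subsingleton (Ext N Z (n + 1))) :
    HasInjectiveDimensionLT Z (n + 1) := by
  induction n generalizing Z with
  | zero =>
    exact injective_iff_hasInjectiveDimensionLT_one.1
      (ModuleCat.injective_of_subsingleton_ext_one_finite Z h)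
  | succ n ih =>
    let ⟨p⟩ := EnoughInjectives.presentation Z
    have hS : (ShortComplex.mk p.f _ (Limits.cokernel.condition p.f)).ShortExact :=
      { exact := ShortComplex.exact_cokernel p.f }
    refine (hS.hasInjectiveDimensionLT_X₃_iff n p.injective).1 (ih _ fun N hN ↦ ?_)
    refine subsingleton_of_forall_eq 0 fun x ↦ ?_
    obtain ⟨y, rfl⟩ := Ext.covariant_sequence_exact₃ _ hS x rfl
      ((h N hN).elim _ _)
    have := p.injective
    have hy : y = 0 := y.eq_zero_of_injective
    rw [hy, Ext.zero_comp]

end InjectiveDimension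

/-! ### Maximal regular sequences -/

section Depth

variable (R : Type u) [CommRing R] [IsLocalRing R]

lemma exists_maximal_isRegular (h : localRingDepth R ≠ ⊤) :
    ∃ rs : List R, IsRegular R rs ∧ (rs.length : ℕ∞) = localRingDepth R ∧
      ∀ r ∈ maximalIdeal R, ¬ IsSMulRegular (R ⧸ Ideal.ofList rs) r := by
  let s : Set (List R) := {rs | (∀ r ∈ rs, r ∈ maximalIdeal R) ∧ IsRegular R rs}
  have : Nonempty s := ⟨⟨[], by simp, IsRegular.nil R R⟩⟩
  have hs : localRingDepth R = ⨆ rs : s, (rs.1.length : ℕ∞) := by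
    rw [localRingDepth, iSup_subtype']
  obtain ⟨⟨rs, hm, hreg⟩, hrs⟩ := ENat.exists_eq_iSup_of_lt_top
    (f := fun rs : s ↦ (rs.1.length : ℕ∞)) (hs ▸ h.lt_top)
  refine ⟨rs, hreg, hrs.trans hs.symm, fun r hr hr' ↦ ?_⟩
  have hm' : ∀ x ∈ rs ++ [r], x ∈ maximalIdeal R := by
    intro x hx
    rcases List.mem_append.1 hx with hx | hx
    · exact hm x hx
    · rwa [List.mem_singleton.1 hx]
  have hreg' : IsRegular R (rs ++ [r]) := by
    rw [IsLocalRing.isRegular_iff_isWeaklyRegular_of_subset_maximalIdeal hm',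
      isWeaklyRegular_append_iff, isWeaklyRegular_singleton_iff]
    refine ⟨hreg.1, ?_⟩
    rwa [smul_eq_mul, Ideal.mul_top]
  have := le_iSup (fun rs : s ↦ (rs.1.length : ℕ∞)) ⟨rs ++ [r], hm', hreg'⟩
  rw [← hrs] at this
  simp only [List.length_append, List.length_singleton, Nat.cast_le] at this
  lia

/-- By maximality no element of the maximal ideal is regular on `R/(rs)`, so there is a nonzero map
from the residue field, injective by simplicity. -/
lemma exists_isRegular_and_injective_residueField [IsNoetherianRing R] (h : localRingDepth R ≠ ⊤) :
    ∃ rs : List R, IsRegular R rs ∧ (rs.length : ℕ∞) = localRingDepth R ∧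
      ∃ f : (R ⧸ maximalIdeal R) →ₗ[R] R ⧸ Ideal.ofList rs, Function.Injective f := by
  obtain ⟨rs, hreg, hlen, hmax⟩ := exists_maximal_isRegular R h
  refine ⟨rs, hreg, hlen, ?_⟩
  have : ¬ Subsingleton ((R ⧸ maximalIdeal R) →ₗ[R] R ⧸ Ideal.ofList rs) := by
    rw [IsSMulRegular.subsingleton_linearMap_iff]
    rintro ⟨r, hr, hr'⟩
    rw [Ideal.annihilator_quotient] at hr
    exact hmax r hr hr'
  rw [not_subsingleton_iff_nontrivial] at this
  obtain ⟨f, hf⟩ := exists_ne (0 : (R ⧸ maximalIdeal R) →ₗ[R] R ⧸ Ideal.ofList rs)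
  have : IsSimpleModule R (R ⧸ maximalIdeal R) :=
    isSimpleModule_iff_isCoatom.2 (maximalIdeal.isMaximal R).out
  exact ⟨f, f.injective_or_eq_zero.resolve_right hf⟩

end Depth

/-! ### Bass's bound for Ext-finite modules -/

section Bass

variable {R : Type u} [CommRing R] [Small.{v} R]

/-- `Ext^i(L, Z) → Ext^i(N, Z)` is onto, its obstruction lying in `Ext^{i+1}(L/N, Z) = 0`. -/
lemma subsingleton_ext_of_injective_of_subsingleton_ext {Z : ModuleCat.{v} R} {i : ℕ}
    (hi : ∀ N : ModuleCat.{v} R, Module.Finite R N → Subsingleton (Ext N Z (i + 1)))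
    {N L : ModuleCat.{v} R} [Module.Finite R L] (f : N →ₗ[R] L) (hf : Function.Injective f)
    (hL : Subsingleton (Ext L Z i)) : Subsingleton (Ext N Z i) := by
  let S : ShortComplex (ModuleCat.{v} R) :=
    ModuleCat.shortComplexOfCompEqZero f f.range.mkQ f.exact_map_mkQ_range.linearMap_comp_eq_zero
  have hS : S.ShortExact :=
    ModuleCat.shortComplex_shortExact S f.exact_map_mkQ_range hf (Submodule.mkQ_surjective _)
  have : Subsingleton (Ext S.X₃ Z (i + 1)) :=
    hi S.X₃ (inferInstanceAs (Module.Finite R (L ⧸ f.range)))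
  refine subsingleton_of_forall_eq 0 fun x ↦ ?_
  obtain ⟨y, rfl⟩ := Ext.contravariant_sequence_exact₁ hS Z x (add_comm 1 i)
    (Subsingleton.elim _ _)
  rw [show y = 0 from hL.elim _ _, Ext.comp_zero]

variable [IsLocalRing R]

/-- As `Ext^{i+1}(N/xN, Z) = 0`, multiplication by `x` is onto on `Ext^i(N, Z)`; Nakayama concludes.
-/
lemma subsingleton_ext_of_isSMulRegular {Z : ModuleCat.{v} R} {i : ℕ}
    (hi : ∀ N : ModuleCat.{v} R, Module.Finite R N → Subsingleton (Ext N Z (i + 1)))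
    (N : ModuleCat.{v} R) [Module.Finite R N] [Module.Finite R (Ext N Z i)]
    {x : R} (hx : x ∈ maximalIdeal R) (hN : IsSMulRegular N x) : Subsingleton (Ext N Z i) := by
  have hS := hN.smulShortComplex_shortExact
  have : Subsingleton (Ext (N.smulShortComplex x).X₃ Z (i + 1)) :=
    hi _ (inferInstanceAs (Module.Finite R (N ⧸ (x • (⊤ : Submodule R N)))))
  have hsurj : ∀ y : Ext N Z i, ∃ z : Ext N Z i, x • z = y := fun y ↦ by
    obtain ⟨z, hz⟩ := Ext.contravariant_sequence_exact₁ hS Z y (add_comm 1 i)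
      (Subsingleton.elim _ _)
    have hsmul (w : Ext N Z i) : x • w = (Ext.mk₀ (x • 𝟙 N)).comp w (zero_add i) := by
      rw [Ext.mk₀_smul, Ext.smul_comp, Ext.mk₀_id_comp]
    exact ⟨z, (hsmul z).trans hz⟩
  have htop : (⊤ : Submodule R (Ext N Z i)) ≤ maximalIdeal R • ⊤ := fun y _ ↦ by
    obtain ⟨z, rfl⟩ := hsurj y
    exact Submodule.smul_mem_smul hx trivial
  have := Submodule.eq_bot_of_le_smul_of_le_jacobson_bot (maximalIdeal R) ⊤
    Module.Finite.fg_top htop (IsLocalRing.maximalIdeal_le_jacobson _)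
  exact (Submodule.subsingleton_iff R).1 (subsingleton_of_bot_eq_top this.symm)

variable [IsNoetherianRing R]

/-- A prime filtration reduces to `R/p`. If `p` is not maximal, any `x` in the maximal ideal outside
`p` is regular on `R/p`. -/
lemma subsingleton_ext_of_subsingleton_ext_residueField {Z : ModuleCat.{v} R}
    (hZ : IsExtFinite R Z) {i : ℕ} (hi₁ : 1 ≤ i)
    (hi : ∀ N : ModuleCat.{v} R, Module.Finite R N → Subsingleton (Ext N Z (i + 1)))
    (hk : ∀ N : ModuleCat.{v} R, (N ≃ₗ[R] R ⧸ maximalIdeal R) → Subsingleton (Ext N Z i))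
    (N : ModuleCat.{v} R) (hN : Module.Finite R N) : Subsingleton (Ext N Z i) := by
  change (fun (N : Type v) [AddCommGroup N] [Module R N] [Module.Finite R N] ↦
    Subsingleton (Ext (ModuleCat.of R N) Z i)) N
  refine IsNoetherianRing.induction_on_isQuotientEquivQuotientPrime R (M := N) hN ?_ ?_ ?_
  · intro N _ _ _ _
    have : HasProjectiveDimensionLT (ModuleCat.of R N) 0 :=
      (ModuleCat.isZero_of_subsingleton (ModuleCat.of R N)).hasProjectiveDimensionLT_zero
    exact HasProjectiveDimensionLT.subsingleton (ModuleCat.of R N) 0 i (Nat.zero_le _) Z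
  · intro N _ _ _ p e
    by_cases hp : p.1 = maximalIdeal R
    · exact hk (ModuleCat.of R N) (e.trans (Submodule.quotEquivOfEq _ _ hp))
    · obtain ⟨x, hx, hxp⟩ := SetLike.exists_of_lt
        (lt_of_le_of_ne (IsLocalRing.le_maximalIdeal p.2.ne_top) hp)
      have : Module.Finite R (Ext (ModuleCat.of R N) Z i) :=
        hZ (ModuleCat.of R N) inferInstance i hi₁
      refine subsingleton_ext_of_isSMulRegular hi (ModuleCat.of R N) hx ?_
      refine (e.isSMulRegular_congr x).2 ?_
      rw [isSMulRegular_iff_right_eq_zero_of_smul]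
      intro y hy
      obtain ⟨y, rfl⟩ := Ideal.Quotient.mk_surjective y
      rw [← Ideal.Quotient.mk_eq_mk, ← Submodule.Quotient.mk_smul, Submodule.Quotient.mk_eq_zero,
        smul_eq_mul] at hy
      exact Ideal.Quotient.eq_zero_iff_mem.2 ((p.2.mem_or_mem hy).resolve_left hxp)
  · intro N₁ _ _ _ N₂ _ _ _ N₃ _ _ _ f g hf hg hfg h₁ h₃
    let S : ShortComplex (ModuleCat.{v} R) :=
      ModuleCat.shortComplexOfCompEqZero f g hfg.linearMap_comp_eq_zero
    have hS : S.ShortExact := ModuleCat.shortComplex_shortExact S hfg hf hg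
    refine subsingleton_of_forall_eq 0 fun x ↦ ?_
    obtain ⟨y, rfl⟩ := Ext.contravariant_sequence_exact₂ hS Z x (h₁.elim _ _)
    rw [show y = 0 from h₃.elim _ _, Ext.comp_zero]

/-- An Ext-finite module of finite injective dimension over a Noetherian local ring has injective
dimension at most the depth of the ring. -/
lemma IsExtFinite.hasInjectiveDimensionLE_of_localRingDepth_eq {Z : ModuleCat.{v} R}
    (hZ : IsExtFinite R Z) {n : ℕ} (hn : HasInjectiveDimensionLT Z n) {d : ℕ}
    (hd : localRingDepth R = d) : HasInjectiveDimensionLE Z d := by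
  obtain ⟨rs, hreg, hlen, f, hf⟩ := exists_isRegular_and_injective_residueField R (by simp [hd])
  obtain rfl : rs.length = d := by exact_mod_cast hlen.trans hd
  let L : ModuleCat.{v} R := ModuleCat.of R (Shrink.{v} (R ⧸ Ideal.ofList rs))
  have : Module.Finite R L := Module.Finite.equiv (Shrink.linearEquiv R _).symm
  have hL : HasProjectiveDimensionLE L rs.length := by
    rw [← projectiveDimension_le_iff, ModuleCat.projectiveDimension_quotient_eq_length rs hreg]
  -- Descending induction on `i`, starting from `i ≥ n`. The residue field embeds in `L`, and
  -- `Ext^i(L, Z) = 0` because `i` exceeds the projective dimension of `L`.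
  have key : ∀ k i : ℕ, rs.length < i → n ≤ i + k →
      ∀ N : ModuleCat.{v} R, Module.Finite R N → Subsingleton (Ext N Z i) := by
    intro k
    induction k with
    | zero => exact fun i _ hi N _ ↦ HasInjectiveDimensionLT.subsingleton Z n i hi N
    | succ k ih =>
      intro i hi hik
      have hsucc := ih (i + 1) (by lia) (by lia)
      refine subsingleton_ext_of_subsingleton_ext_residueField hZ (by lia) hsucc fun N e ↦ ?_
      exact subsingleton_ext_of_injective_of_subsingleton_ext hsucc (L := L)
        ((Shrink.linearEquiv R (R ⧸ Ideal.ofList rs)).symm.toLinearMap ∘ₗ f ∘ₗ e.toLinearMap)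
        ((Shrink.linearEquiv R (R ⧸ Ideal.ofList rs)).symm.injective.comp
          (hf.comp e.injective))
        (HasProjectiveDimensionLT.subsingleton L (rs.length + 1) i hi Z)
  exact ModuleCat.hasInjectiveDimensionLT_succ_of_forall_finite Z _
    (key n (rs.length + 1) (by lia) (by lia))

end Bass

/-! ### Cycles and canonical truncation of complexes -/

section Complex

/-- The embedding of `ℕ` in `ℤ` with image the integers `≥ p`, for homologically indexed
complexes. -/
@[simps!]
def ComplexShape.embeddingDownIntGE (p : ℤ) :
    (ComplexShape.down ℕ).Embedding (ComplexShape.down ℤ) :=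
  ComplexShape.Embedding.mk' _ _ (fun n ↦ p + n)
    (fun _ _ h ↦ by dsimp at h; lia) (fun _ _ ↦ by simp only [ComplexShape.down_Rel]; lia)

instance (p : ℤ) : (ComplexShape.embeddingDownIntGE p).IsRelIff where
  rel' i j h := by
    simp only [ComplexShape.down_Rel, ComplexShape.embeddingDownIntGE_f] at h ⊢; lia

instance (p : ℤ) : (ComplexShape.embeddingDownIntGE p).IsTruncLE where
  mem_prev {_ k} h := ⟨k + 1, by
    simp only [ComplexShape.down_Rel, ComplexShape.embeddingDownIntGE_f] at h ⊢; push_cast; lia⟩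

lemma ComplexShape.embeddingDownIntGE_boundaryLE_iff (p : ℤ) (n : ℕ) :
    (embeddingDownIntGE p).BoundaryLE n ↔ n = 0 := by
  constructor
  · rintro ⟨-, h⟩
    by_contra hn
    exact h (n - 1) (by simp only [ComplexShape.down_Rel, ComplexShape.embeddingDownIntGE_f]; lia)
  · rintro rfl
    refine ComplexShape.Embedding.boundaryLE (k' := p - 1) _ (by simp) fun i ↦ ?_
    simp only [ComplexShape.embeddingDownIntGE_f]; lia

variable {C : Type*} [Category C] [Abelian C]

namespace ChainComplex

variable (K : ChainComplex C ℤ)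

/-- The boundaries of a chain complex, as the kernel of the projection of cycles on homology. -/
noncomputable abbrev boundaries (i : ℤ) : C := Limits.kernel (K.homologyπ i)

/-- The short exact sequence `0 → Bᵢ → Zᵢ → Hᵢ → 0`. -/
noncomputable abbrev boundariesCyclesShortComplex (i : ℤ) : ShortComplex C :=
  ShortComplex.mk (Limits.kernel.ι (K.homologyπ i)) (K.homologyπ i) (Limits.kernel.condition _)

lemma boundariesCyclesShortComplex_shortExact (i : ℤ) :
    (K.boundariesCyclesShortComplex i).ShortExact where
  exact := ShortComplex.exact_kernel _

/-- The short exact sequence `0 → Zᵢ → Kᵢ → Bⱼ → 0` for `j + 1 = i`. -/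
noncomputable abbrev cyclesShortComplex (i j : ℤ) : ShortComplex C :=
  ShortComplex.mk (K.iCycles i) (Limits.kernel.lift (K.homologyπ j) (K.toCycles i j) (by simp))
    (by
      rw [← cancel_mono (Limits.kernel.ι _), ← cancel_mono (K.iCycles j)]
      simp)

lemma cyclesShortComplex_shortExact {i j : ℤ} (h : j + 1 = i) :
    (K.cyclesShortComplex i j).ShortExact where
  exact := by
    have hk := K.cyclesIsKernel i j ((ComplexShape.down ℤ).next_eq' h)
    have hw {A : C} (k : A ⟶ K.X i)
        (hk' : k ≫ Limits.kernel.lift (K.homologyπ j) (K.toCycles i j) (by simp) = 0) :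
        k ≫ K.d i j = 0 := by
      rw [← K.toCycles_i i j, ← Limits.kernel.lift_ι (K.homologyπ j) (K.toCycles i j) (by simp),
        ← Category.assoc, ← Category.assoc, hk', Limits.zero_comp, Limits.zero_comp]
    refine ShortComplex.exact_of_f_is_kernel _ (Limits.KernelFork.IsLimit.ofι' _ _
      (fun {A} k hk' ↦ ⟨hk.lift (Limits.KernelFork.ofι k (hw k hk')), ?_⟩))
    exact hk.fac (Limits.KernelFork.ofι k (hw k hk')) Limits.WalkingParallelPair.zero
  epi_g := by
    let T := ShortComplex.mk (K.toCycles i j) (K.homologyπ j) (by simp)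
    have hT : T.Exact := ShortComplex.exact_of_g_is_cokernel _
      (K.homologyIsCokernel i j ((ComplexShape.down ℤ).prev_eq' h))
    exact hT.epi_kernelLift

variable {K}

lemma isZero_cycles {i : ℤ} (h : Limits.IsZero (K.X i)) : Limits.IsZero (K.cycles i) :=
  Limits.IsZero.of_mono (K.iCycles i) h

lemma isZero_homology {i : ℤ} (h : Limits.IsZero (K.X i)) : Limits.IsZero (K.homology i) :=
  Limits.IsZero.of_epi (K.homologyπ i) (isZero_cycles h)

lemma isIso_kernel_homologyπ {i : ℤ} (h : Limits.IsZero (K.homology i)) :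
    IsIso (Limits.kernel.ι (K.homologyπ i)) := by
  rw [show K.homologyπ i = 0 from h.eq_of_tgt _ _]
  infer_instance

lemma hasInjectiveDimensionLT_boundaries_iff {j : ℤ} (h : Limits.IsZero (K.homology j)) (n : ℕ) :
    HasInjectiveDimensionLT (K.boundaries j) n ↔ HasInjectiveDimensionLT (K.cycles j) n :=
  have := isIso_kernel_homologyπ h
  ⟨fun _ ↦ hasInjectiveDimensionLT_of_iso (asIso (Limits.kernel.ι (K.homologyπ j))) n,
    fun _ ↦ hasInjectiveDimensionLT_of_iso (asIso (Limits.kernel.ι (K.homologyπ j))).symm n⟩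

/-- Exactness at `j` gives `0 → Z_i → K_i → Z_j → 0`, so dimension shifting applies. -/
lemma hasInjectiveDimensionLT_cycles_iff {i j : ℤ} (hij : j + 1 = i) (hi : Injective (K.X i))
    (h : Limits.IsZero (K.homology j)) (n : ℕ) :
    HasInjectiveDimensionLT (K.cycles j) (n + 1) ↔ HasInjectiveDimensionLT (K.cycles i) (n + 2) := by
  rw [← hasInjectiveDimensionLT_boundaries_iff h]
  exact (K.cyclesShortComplex_shortExact hij).hasInjectiveDimensionLT_X₃_iff n hi

lemma exists_hasInjectiveDimensionLT_cycles (hinj : ∀ i, Injective (K.X i)) {m h : ℤ}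
    (hm : ∀ i < m, Limits.IsZero (K.X i)) (hh : ∀ i < h, Limits.IsZero (K.homology i)) :
    ∃ n : ℕ, HasInjectiveDimensionLT (K.cycles h) n := by
  -- Ascending from degrees below `m`, where the cycles vanish; each degree costs one dimension.
  suffices ∀ k : ℕ, ∀ i : ℤ, i ≤ h → i < m + k → HasInjectiveDimensionLT (K.cycles i) (k + 1) from
    ⟨(h - m + 1).toNat + 1, this _ h le_rfl (by lia)⟩
  intro k
  induction k with
  | zero =>
    intro i _ hi
    have := (isZero_cycles (hm i (by simpa using hi))).hasInjectiveDimensionLT_zero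
    exact hasInjectiveDimensionLT_of_ge _ 0 _ (by lia)
  | succ k ih =>
    intro i hih hi
    refine (hasInjectiveDimensionLT_cycles_iff (j := i - 1) (by lia) (hinj i)
      (hh _ (by lia)) k).1 (ih _ (by lia) ?_)
    push_cast at hi
    lia

lemma injective_cycles_sub (hinj : ∀ i, Injective (K.X i)) {d : ℕ} {h : ℤ}
    (hh : ∀ i < h, Limits.IsZero (K.homology i)) (hd : HasInjectiveDimensionLE (K.cycles h) d) :
    Injective (K.cycles (h - d)) := by
  induction d generalizing h with
  | zero =>
    rw [Nat.cast_zero, sub_zero]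
    exact injective_iff_hasInjectiveDimensionLT_one.2 hd
  | succ d ih =>
    have := ih (h := h - 1) (fun i hi ↦ hh i (by lia))
      ((hasInjectiveDimensionLT_cycles_iff (by lia) (hinj h) (hh _ (by lia)) d).2 hd)
    rwa [show h - ((d + 1 : ℕ) : ℤ) = h - 1 - d by push_cast; lia]

lemma isZero_truncLE_X_of_lt (K : ChainComplex C ℤ) {p i : ℤ} (hi : i < p) :
    Limits.IsZero ((K.truncLE (ComplexShape.embeddingDownIntGE p)).X i) :=
  (K.truncLE (ComplexShape.embeddingDownIntGE p)).isZero_X_of_isStrictlySupported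
    (ComplexShape.embeddingDownIntGE p) i
    (fun k ↦ by simp only [ComplexShape.embeddingDownIntGE_f]; lia)

lemma injective_truncLE_X (hinj : ∀ i, Injective (K.X i)) {p : ℤ} (hp : Injective (K.cycles p))
    (i : ℤ) : Injective ((K.truncLE (ComplexShape.embeddingDownIntGE p)).X i) := by
  by_cases hi : p ≤ i
  · obtain ⟨k, rfl⟩ := Int.le.dest hi
    by_cases hk : k = 0
    · have e := K.truncLEXIsoCycles (ComplexShape.embeddingDownIntGE p) (i := k) rfl
        ((ComplexShape.embeddingDownIntGE_boundaryLE_iff p k).2 hk)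
      refine Injective.of_iso e.symm ?_
      subst hk
      simpa using hp
    · have e := K.truncLEXIso (ComplexShape.embeddingDownIntGE p) (i := k) rfl
        (fun h ↦ hk ((ComplexShape.embeddingDownIntGE_boundaryLE_iff p k).1 h))
      exact Injective.of_iso e.symm (hinj _)
  · exact (isZero_truncLE_X_of_lt K (not_le.1 hi)).injective

lemma isZero_truncLE_X (p : ℤ) {i : ℤ} (hi : Limits.IsZero (K.X i)) :
    Limits.IsZero ((K.truncLE (ComplexShape.embeddingDownIntGE p)).X i) :=
  Limits.IsZero.of_mono ((K.ιTruncLE (ComplexShape.embeddingDownIntGE p)).f i) hi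

/-- Canonical truncation does not change the homology of a complex that is exact in the degrees
that are cut off. -/
lemma nonempty_truncLE_homology_iso {p : ℤ} (hp : ∀ i < p, Limits.IsZero (K.homology i)) (i : ℤ) :
    Nonempty ((K.truncLE (ComplexShape.embeddingDownIntGE p)).homology i ≅ K.homology i) := by
  by_cases hi : p ≤ i
  · obtain ⟨k, rfl⟩ := Int.le.dest hi
    have : QuasiIsoAt (K.ιTruncLE (ComplexShape.embeddingDownIntGE p)) (p + k) :=
      K.quasiIsoAt_ιTruncLE (ComplexShape.embeddingDownIntGE p) (j := k) rfl
    exact ⟨isoOfQuasiIsoAt (K.ιTruncLE (ComplexShape.embeddingDownIntGE p)) _⟩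
  · rw [not_le] at hi
    exact ⟨(isZero_homology (isZero_truncLE_X_of_lt K hi)).iso (hp i hi)⟩

end ChainComplex

end Complex

/-! ### Truncating a resolution and the bound -/

section Main

variable {R : Type u} [CommRing R]

lemma IsQuasiInjectiveResolution.truncLE {M : Type v} [AddCommGroup M] [Module R M]
    {I : ChainComplex (ModuleCat.{v} R) ℤ} (hI : IsQuasiInjectiveResolution R M I) {p : ℤ}
    (hp : ∀ i < p, Limits.IsZero (I.homology i)) (hinj : Injective (I.cycles p)) :
    IsQuasiInjectiveResolution R M (I.truncLE (ComplexShape.embeddingDownIntGE p)) where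
  boundedAbove := by
    obtain ⟨n, hn⟩ := hI.boundedAbove
    exact ⟨n, fun i hi ↦ ChainComplex.isZero_truncLE_X p (hn i hi)⟩
  injective := ChainComplex.injective_truncLE_X hI.injective hinj
  homology := by
    obtain ⟨b, hb, hH⟩ := hI.homology
    refine ⟨b, hb, fun i ↦ ?_⟩
    obtain ⟨e⟩ := hH i
    obtain ⟨e'⟩ := ChainComplex.nonempty_truncLE_homology_iso hp i
    exact ⟨e'.toLinearEquiv.trans e⟩

lemma IsQuasiInjectiveResolution.isExtFinite_cycles [IsNoetherianRing R] [Small.{v} R]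
    {M : Type v} [AddCommGroup M] [Module R M] (hM : IsExtFinite R M)
    {I : ChainComplex (ModuleCat.{v} R) ℤ} (hI : IsQuasiInjectiveResolution R M I) (i : ℤ) :
    IsExtFinite R (I.cycles i) := by
  obtain ⟨n, hn⟩ := hI.boundedAbove
  obtain ⟨b, -, hH⟩ := hI.homology
  suffices ∀ k : ℕ, ∀ i : ℤ, n < i + k → IsExtFinite R (I.cycles i) from
    this (n + 1 - i).toNat i (by lia)
  intro k
  induction k with
  | zero =>
    intro i hi
    have := ModuleCat.subsingleton_of_isZero
      (ChainComplex.isZero_cycles (hn i (by simpa using hi)))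
    exact isExtFinite_of_subsingleton _
  | succ k ih =>
    intro i hi
    obtain ⟨e⟩ := hH i
    have := hI.injective (i + 1)
    exact (I.boundariesCyclesShortComplex_shortExact i).isExtFinite_X₂
      ((I.cyclesShortComplex_shortExact (i := i + 1) rfl).isExtFinite_X₃
        (ih (i + 1) (by push_cast at hi; lia)))
      (hM.of_linearEquiv_fin_fun _ e)

theorem corollary3p3 (R : Type u) [CommRing R] [IsNoetherianRing R] [IsLocalRing R] [Small.{v} R]
    (M : Type v) [AddCommGroup M] [Module R M] [Nontrivial M]
    (hExt : IsExtFinite R M) (hqid : quasiInjectiveDimension R M < ⊤) :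
    quasiInjectiveDimension R M ≤ (localRingDepth R : WithBot ℕ∞) := by
  rw [quasiInjectiveDimension, if_neg (not_subsingleton M)] at hqid ⊢
  rw [WithBot.coe_le_coe]
  by_cases hdepth : localRingDepth R = ⊤
  · simp [hdepth]
  obtain ⟨d, hd⟩ := ENat.ne_top_iff_exists.1 hdepth
  obtain ⟨n, I, hI, ⟨m, n', hb⟩, a, -, hh⟩ : Set.Nonempty
      {n : ℕ | ∃ I : ChainComplex (ModuleCat.{v} R) ℤ,
        IsQuasiInjectiveResolution R M I ∧ IsBoundedChainComplex I ∧
        ∃ a : ℤ, HasInf I a ∧ HasHinf I (a + n)} := by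
    rw [Set.nonempty_iff_ne_empty]
    intro h
    rw [h] at hqid
    simp at hqid
  -- Only `hinf I` matters; the length of `I` below it is forgotten.
  generalize a + (n : ℤ) = h at hh
  have hexact : ∀ i < h, Limits.IsZero (I.homology i) := fun i hi ↦ by
    by_contra hi'
    exact absurd (hh.2 hi') (by lia)
  obtain ⟨s, hs⟩ := ChainComplex.exists_hasInjectiveDimensionLT_cycles hI.injective
    (fun i hi ↦ hb i (Or.inl hi)) hexact
  have hinj : Injective (I.cycles (h - d)) := ChainComplex.injective_cycles_sub hI.injective hexact
    ((hI.isExtFinite_cycles hExt h).hasInjectiveDimensionLE_of_localRingDepth_eq hs hd.symm)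
  have hexact' : ∀ i < h - d, Limits.IsZero (I.homology i) := fun i hi ↦ hexact i (by lia)
  let J := I.truncLE (ComplexShape.embeddingDownIntGE (h - d))
  have hJ (i : ℤ) : Limits.IsZero (J.homology i) ↔ Limits.IsZero (I.homology i) :=
    (ChainComplex.nonempty_truncLE_homology_iso hexact' i).some.isZero_iff
  have hhJ : HasHinf J h := by
    simpa only [HasHinf, hJ] using hh
  have hXh : ¬ Limits.IsZero (J.X h) := fun h' ↦ hhJ.1 (ChainComplex.isZero_homology h')
  -- `Z_{h-d}` may vanish, so `inf J` is some `c` with `h - d ≤ c ≤ h`, not necessarily `h - d`.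
  obtain ⟨c, hc, hcmin⟩ := Int.exists_least_of_bdd (P := fun i ↦ ¬ Limits.IsZero (J.X i))
    ⟨h - d, fun i hi ↦ by
      by_contra hlt
      exact hi (ChainComplex.isZero_truncLE_X_of_lt I (by lia))⟩ ⟨h, hXh⟩
  have hch : c ≤ h := hcmin h hXh
  have hdc : h - d ≤ c := by
    by_contra hlt
    exact hc (ChainComplex.isZero_truncLE_X_of_lt I (by lia))
  refine (iInf₂_le (h - c).toNat ⟨J, hI.truncLE hexact' hinj,
    ⟨m, n', fun i hi ↦ ChainComplex.isZero_truncLE_X _ (hb i hi)⟩, c, ⟨hc, fun i hi ↦ hcmin i hi⟩,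
    ?_⟩).trans ?_
  · rw [← hd, Nat.cast_le]
    lia
  · rwa [show c + ((h - c).toNat : ℤ) = h by lia]

end Main
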